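/- **Theorem 4.1 (Projective Cauchy formula).** Let the hyperbolic plane $\mathbb{H}^2$ of curvature $k=-1$ be represented by the Beltrami–Klein model, i.e. by the open unit disk centred at the origin $O$ of the Euclidean plane, with the distance $$h(P,Q)=\tfrac12\log\left(\frac{AQ}{AP}\cdot\frac{BP}{BQ}\right)=\operatorname{arcosh}\frac{1-P\cdot Q}{\sqrt{1-|P|^2}\,\sqrt{1-|Q|^2}},$$ where for $P\ne Q$ the line through $P$ and $Q$ strikes the unit circle at $A$ and $B$ in the order $A,P,Q,B$, and $h(P,P)=0$. Let $K$ be a convex body in $\mathbb{H}^2$, i.e. a nonempty compact convex subset of the open unit disk. For $\varphi\in[0,2\pi]$ let $R=(\cos\varphi,\sin\varphi)$, let the $\varphi$-normal be the line through $O$ perpendicular to $OR$, and let $w(\varphi)$ be the Euclidean length of the projection of $K$ from $R$ onto the $\varphi$-normal, i.e. of the segment formed by the points in which the lines through $R$ and the points of $K$ meet the $\varphi$-normal (it may reach outside the disk). Then $w$ is integrable on $[0,2\pi]$, and the hyperbolic perimeter of $K$ is $$\mathcal{P}=\frac12\int_0^{2\pi} w\,d\varphi .$$ Here, if $K$ has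 nonempty interior, $\mathcal{P}$ is the hyperbolic length of the simple closed curve $\partial K$ (the supremum of the $h$-lengths of inscribed polygonal paths, in any simple closed parametrization); if $K$ is a segment or a point, it is regarded as a two-gon, and $\mathcal{P}$ is twice its hyperbolic length. -/

import Mathlib

open Set Metric MeasureTheory
open scoped ENNReal

/-- The Euclidean plane containing the Beltrami–Klein model. -/
abbrev Plane : Type := EuclideanSpace ℝ (Fin 2)

/-- The points of the Beltrami–Klein model of the hyperbolic plane: the open unit disk.
(A structure, so that it does not inherit the Euclidean metric.) -/
@[ext]
structure KleinDisk : Type where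
  /-- the underlying point of the Euclidean plane -/
  pt : Plane
  /-- it lies in the open unit disk -/
  norm_lt_one : ‖pt‖ < 1

namespace KleinDisk

/-- The hyperbolic cosine of the distance of two points in the Beltrami–Klein model
(curvature `-1`). -/
noncomputable def coshDist (p q : KleinDisk) : ℝ :=
  (1 - inner ℝ p.pt q.pt) / (√(1 - ‖p.pt‖ ^ 2) * √(1 - ‖q.pt‖ ^ 2))

theorem aux_pos (p : KleinDisk) : 0 < 1 - ‖p.pt‖ ^ 2 := by
  nlinarith [p.norm_lt_one, norm_nonneg p.pt]

theorem aux_inner (x y : Plane) : inner ℝ x y = x 0 * y 0 + x 1 * y 1 := by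
  simp [PiLp.inner_apply, Fin.sum_univ_two, mul_comm]

theorem aux_norm (x : Plane) : ‖x‖ ^ 2 = x 0 ^ 2 + x 1 ^ 2 := by
  simp [EuclideanSpace.norm_sq_eq, Fin.sum_univ_two]

theorem aux_num_pos (p q : KleinDisk) : 0 < 1 - inner ℝ p.pt q.pt := by
  have h := real_inner_le_norm p.pt q.pt
  nlinarith [p.norm_lt_one, q.norm_lt_one, norm_nonneg p.pt, norm_nonneg q.pt]

theorem coshDist_comm (p q : KleinDisk) : coshDist p q = coshDist q p := by
  rw [coshDist, coshDist, real_inner_comm, mul_comm (√_)]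

theorem coshDist_pos (p q : KleinDisk) : 0 < coshDist p q :=
  div_pos (aux_num_pos p q)
    (mul_pos (Real.sqrt_pos.2 (aux_pos p)) (Real.sqrt_pos.2 (aux_pos q)))

theorem coshDist_sq (p q : KleinDisk) : coshDist p q ^ 2 =
    (1 - inner ℝ p.pt q.pt) ^ 2 / ((1 - ‖p.pt‖ ^ 2) * (1 - ‖q.pt‖ ^ 2)) := by
  rw [coshDist, div_pow, mul_pow, Real.sq_sqrt (aux_pos p).le, Real.sq_sqrt (aux_pos q).le]

theorem one_le_coshDist (p q : KleinDisk) : 1 ≤ coshDist p q := by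
  have h : (1 : ℝ) ^ 2 ≤ coshDist p q ^ 2 := by
    rw [coshDist_sq, one_pow, one_le_div (mul_pos (aux_pos p) (aux_pos q))]
    have hq := aux_pos q
    rw [aux_norm] at hq
    rw [aux_inner, aux_norm, aux_norm]
    nlinarith [sq_nonneg ((p.pt 0 - q.pt 0) * q.pt 0 + (p.pt 1 - q.pt 1) * q.pt 1),
      mul_nonneg hq.le (add_nonneg (sq_nonneg (p.pt 0 - q.pt 0)) (sq_nonneg (p.pt 1 - q.pt 1)))]
  exact le_of_sq_le_sq h (coshDist_pos p q).le

theorem coshDist_self (p : KleinDisk) : coshDist p p = 1 := by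
  rw [coshDist, real_inner_self_eq_norm_sq, Real.mul_self_sqrt (aux_pos p).le,
    div_self (aux_pos p).ne']

theorem eq_of_coshDist_eq_one {p q : KleinDisk} (h : coshDist p q = 1) : p = q := by
  have h2 := coshDist_sq p q
  rw [h, one_pow, eq_div_iff (mul_pos (aux_pos p) (aux_pos q)).ne'] at h2
  have hq := aux_pos q
  rw [aux_norm] at hq
  rw [aux_inner, aux_norm, aux_norm] at h2
  have h3 : (p.pt 0 - q.pt 0) ^ 2 + (p.pt 1 - q.pt 1) ^ 2 ≤ 0 := by
    by_contra hc
    nlinarith [sq_nonneg ((p.pt 0 - q.pt 0) * q.pt 0 + (p.pt 1 - q.pt 1) * q.pt 1),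
      mul_pos hq (not_le.1 hc)]
  have h0 : p.pt 0 = q.pt 0 := by
    nlinarith [sq_nonneg (p.pt 0 - q.pt 0), sq_nonneg (p.pt 1 - q.pt 1)]
  have h1 : p.pt 1 = q.pt 1 := by
    nlinarith [sq_nonneg (p.pt 0 - q.pt 0), sq_nonneg (p.pt 1 - q.pt 1)]
  ext i
  fin_cases i
  · exact h0
  · exact h1

theorem aux_gram (p q r : KleinDisk) :
    (coshDist p r - coshDist p q * coshDist q r) ^ 2 ≤
      (coshDist p q ^ 2 - 1) * (coshDist q r ^ 2 - 1) := by
  have hp := aux_pos p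
  have hq := aux_pos q
  have hr := aux_pos r
  have e : coshDist p r * (coshDist p q * coshDist q r) =
      (1 - inner ℝ p.pt r.pt) * (1 - inner ℝ p.pt q.pt) * (1 - inner ℝ q.pt r.pt) /
        ((1 - ‖p.pt‖ ^ 2) * (1 - ‖q.pt‖ ^ 2) * (1 - ‖r.pt‖ ^ 2)) := by
    unfold coshDist
    rw [div_mul_div_comm, div_mul_div_comm]
    congr 1
    · ring
    · have a := Real.mul_self_sqrt hp.le
      have b := Real.mul_self_sqrt hq.le
      have c := Real.mul_self_sqrt hr.le
      calc _ = (√(1 - ‖p.pt‖ ^ 2) * √(1 - ‖p.pt‖ ^ 2)) * (√(1 - ‖q.pt‖ ^ 2) * √(1 - ‖q.pt‖ ^ 2)) *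
            (√(1 - ‖r.pt‖ ^ 2) * √(1 - ‖r.pt‖ ^ 2)) := by ring
        _ = _ := by rw [a, b, c]
  have key : 0 ≤ 1 + 2 * (coshDist p r * (coshDist p q * coshDist q r)) -
      coshDist p r ^ 2 - coshDist p q ^ 2 - coshDist q r ^ 2 := by
    rw [e, coshDist_sq, coshDist_sq, coshDist_sq]
    have : 1 + 2 * ((1 - inner ℝ p.pt r.pt) * (1 - inner ℝ p.pt q.pt) * (1 - inner ℝ q.pt r.pt) /
          ((1 - ‖p.pt‖ ^ 2) * (1 - ‖q.pt‖ ^ 2) * (1 - ‖r.pt‖ ^ 2))) -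
        (1 - inner ℝ p.pt r.pt) ^ 2 / ((1 - ‖p.pt‖ ^ 2) * (1 - ‖r.pt‖ ^ 2)) -
        (1 - inner ℝ p.pt q.pt) ^ 2 / ((1 - ‖p.pt‖ ^ 2) * (1 - ‖q.pt‖ ^ 2)) -
        (1 - inner ℝ q.pt r.pt) ^ 2 / ((1 - ‖q.pt‖ ^ 2) * (1 - ‖r.pt‖ ^ 2)) =
        ((q.pt 0 - p.pt 0) * (r.pt 1 - p.pt 1) - (q.pt 1 - p.pt 1) * (r.pt 0 - p.pt 0)) ^ 2 /
          ((1 - ‖p.pt‖ ^ 2) * (1 - ‖q.pt‖ ^ 2) * (1 - ‖r.pt‖ ^ 2)) := by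
      have hp' := hp.ne'
      have hq' := hq.ne'
      have hr' := hr.ne'
      field_simp
      simp only [aux_inner, aux_norm]
      ring
    rw [this]
    positivity
  nlinarith [key]

theorem arcosh_triangle (p q r : KleinDisk) : Real.arcosh (coshDist p r) ≤
    Real.arcosh (coshDist p q) + Real.arcosh (coshDist q r) := by
  have h1 := one_le_coshDist p q
  have h2 := one_le_coshDist q r
  have hle : coshDist p r ≤
      Real.cosh (Real.arcosh (coshDist p q) + Real.arcosh (coshDist q r)) := by
    rw [Real.cosh_add, Real.cosh_arcosh h1, Real.cosh_arcosh h2, Real.sinh_arcosh h1,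
      Real.sinh_arcosh h2, ← Real.sqrt_mul (by nlinarith)]
    linarith [Real.le_sqrt_of_sq_le (aux_gram p q r)]
  rw [← Real.arcosh_cosh (add_nonneg (Real.arcosh_nonneg h1) (Real.arcosh_nonneg h2))]
  exact (Real.arcosh_le_arcosh (coshDist_pos p r) (Real.cosh_pos _)).2 hle

/-- The hyperbolic metric of curvature `-1` on the Beltrami–Klein model. -/
noncomputable instance : MetricSpace KleinDisk where
  dist p q := Real.arcosh (coshDist p q)
  dist_self p := by rw [coshDist_self, Real.arcosh_zero]
  dist_comm p q := by rw [coshDist_comm]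
  dist_triangle := arcosh_triangle
  eq_of_dist_eq_zero {p q} h :=
    eq_of_coshDist_eq_one ((Real.arcosh_eq_zero_iff (one_le_coshDist p q)).1 h)

theorem dist_def (p q : KleinDisk) : dist p q = Real.arcosh (coshDist p q) := rfl

/-- The metric is the Hilbert metric of the unit disk: if the line through `P` and `Q` strikes the
unit circle at `A` and `B`, in the order `A P Q B`, then
`dist P Q = (1 / 2) * log (AQ / AP * (BP / BQ))`. -/
theorem dist_eq_hilbert {A B : Plane} (hA : ‖A‖ = 1) (hB : ‖B‖ = 1) {P Q : KleinDisk} {s t : ℝ}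
    (hs : 0 < s) (hst : s ≤ t) (ht : t < 1) (hP : P.pt = AffineMap.lineMap A B s)
    (hQ : Q.pt = AffineMap.lineMap A B t) :
    dist P Q = 1 / 2 * Real.log
      (dist A Q.pt / dist A P.pt * (dist B P.pt / dist B Q.pt)) := by
  have h1s : 0 < 1 - s := by linarith
  have h1t : 0 < 1 - t := by linarith
  have ht0 : 0 < t := by linarith
  have hAB : A ≠ B := by
    rintro rfl
    have := P.norm_lt_one
    rw [hP, AffineMap.lineMap_same_apply] at this
    linarith
  have hd : dist A B ≠ 0 := dist_ne_zero.2 hAB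
  have hratio : dist A Q.pt / dist A P.pt * (dist B P.pt / dist B Q.pt) =
      t * (1 - s) / (s * (1 - t)) := by
    rw [hP, hQ, dist_left_lineMap, dist_left_lineMap, dist_right_lineMap, dist_right_lineMap]
    simp only [Real.norm_eq_abs, abs_of_pos hs, abs_of_pos ht0, abs_of_pos h1s, abs_of_pos h1t]
    field_simp
  rw [hratio]
  set x : ℝ := t * (1 - s) / (s * (1 - t)) with hx
  have hx1 : 1 ≤ x := by
    rw [hx, one_le_div (by positivity)]
    nlinarith
  have hx0 : 0 < x := by linarith
  have hlog : 0 ≤ 1 / 2 * Real.log x := by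
    have := Real.log_nonneg hx1
    positivity
  have hA' : A 0 ^ 2 + A 1 ^ 2 = 1 := by rw [← aux_norm, hA, one_pow]
  have hB' : B 0 ^ 2 + B 1 ^ 2 = 1 := by rw [← aux_norm, hB, one_pow]
  have hc : ∀ i, (AffineMap.lineMap A B s : Plane) i = (1 - s) * A i + s * B i := by
    intro i
    simp [AffineMap.lineMap_apply]
    ring
  have hc' : ∀ i, (AffineMap.lineMap A B t : Plane) i = (1 - t) * A i + t * B i := by
    intro i
    simp [AffineMap.lineMap_apply]
    ring
  set m : ℝ := 1 - (A 0 * B 0 + A 1 * B 1) with hm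
  have e1 : 1 - ‖P.pt‖ ^ 2 = 2 * (s * (1 - s)) * m := by
    rw [aux_norm, hP, hc, hc, hm]
    linear_combination (-(1 - s) ^ 2) * hA' - s ^ 2 * hB'
  have e2 : 1 - ‖Q.pt‖ ^ 2 = 2 * (t * (1 - t)) * m := by
    rw [aux_norm, hQ, hc', hc', hm]
    linear_combination (-(1 - t) ^ 2) * hA' - t ^ 2 * hB'
  have e3 : 1 - inner ℝ P.pt Q.pt = (s * (1 - t) + t * (1 - s)) * m := by
    rw [aux_inner, hP, hQ, hc, hc, hc', hc', hm]
    linear_combination (-(1 - s) * (1 - t)) * hA' - s * t * hB'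
  have hm0 : 0 < m := by
    have := aux_pos P
    rw [e1] at this
    exact pos_of_mul_pos_right this (by positivity)
  have hcosh : coshDist P Q = Real.cosh (1 / 2 * Real.log x) := by
    have hsq : coshDist P Q ^ 2 = Real.cosh (1 / 2 * Real.log x) ^ 2 := by
      have h2 := Real.cosh_two_mul (1 / 2 * Real.log x)
      have h3 := Real.cosh_sq_sub_sinh_sq (1 / 2 * Real.log x)
      rw [show 2 * (1 / 2 * Real.log x) = Real.log x by ring, Real.cosh_log hx0] at h2
      have h4 : Real.cosh (1 / 2 * Real.log x) ^ 2 = ((x + x⁻¹) / 2 + 1) / 2 := by linarith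
      rw [h4, coshDist_sq, e1, e2, e3, hx]
      field_simp
      ring
    exact (pow_left_inj₀ (coshDist_pos P Q).le (Real.cosh_pos _).le two_ne_zero).1 hsq
  rw [dist_def, hcosh, Real.arcosh_cosh hlog]

end KleinDisk

/-- `γ`, restricted to `[0, 1]`, is a simple closed parametrization of the boundary `∂K` of the
subset `K` of the model. -/
structure IsBoundaryCurve (K : Set Plane) (γ : ℝ → KleinDisk) : Prop where
  continuousOn : ContinuousOn (fun t => (γ t).pt) (Icc 0 1)
  closed : γ 0 = γ 1
  injOn : InjOn γ (Ico 0 1)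
  image_eq : (fun t => (γ t).pt) '' Icc 0 1 = frontier K

/-- `P` is the hyperbolic perimeter of the convex body `K` in the Beltrami–Klein model.
If `K` has interior points, its boundary is a simple closed curve, and `P` is the hyperbolic length
(supremum of the lengths of inscribed polygonal paths) of every simple closed parametrization of
it. If `K` is degenerate (a segment or a point), then `K` is regarded as a two-gon, and `P` is twice
the hyperbolic length of the segment, that is, twice the hyperbolic diameter of `K`. -/
def HasHyperbolicPerimeter (K : ConvexBody Plane) (P : ℝ≥0∞) : Prop :=
  ((interior (K : Set Plane)).Nonempty →
    (∃ γ, IsBoundaryCurve K γ) ∧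
      ∀ γ : ℝ → KleinDisk, IsBoundaryCurve K γ → eVariationOn γ (Icc 0 1) = P) ∧
  (¬ (interior (K : Set Plane)).Nonempty →
    2 * ediam {p : KleinDisk | p.pt ∈ K} = P)

/-- The ideal point `R` with central angle `φ`. -/
noncomputable def idealPoint (φ : ℝ) : Plane := !₂[Real.cos φ, Real.sin φ]

/-- The `φ`-normal: the line through the origin perpendicular to `OR`. -/
def phiNormal (φ : ℝ) : Set Plane := {x | inner ℝ x (idealPoint φ) = 0}

/-- The projection of `K` from the ideal point `R` onto the `φ`-normal: the points of the `φ`-normal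
that lie on a line through `R` and a point of `K`. -/
def projectionFromIdeal (K : Set Plane) (φ : ℝ) : Set Plane :=
  {x | x ∈ phiNormal φ ∧ ∃ p ∈ K, x ∈ line[ℝ, idealPoint φ, p]}

/-- The Euclidean length `w` of the projection of `K` from `R` onto the `φ`-normal (a segment, whose
length is its diameter). -/
noncomputable def projectedWidth (K : Set Plane) (φ : ℝ) : ℝ :=
  diam (projectionFromIdeal K φ)

/-! ### The projection from an ideal point and the two-point formula -/

/-! The proof is Crofton-style: it settles two points first, then sums over inscribed polygons. The
coordinate `idealProj φ p` of the projection from `R` is the `φ`-derivative of `-log (1 - ⟪p, R⟫)`.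
For two points on a chord, the difference of their coordinates changes sign only when `R` passes an
endpoint of the chord. Integrating its absolute value over the circle therefore gives boundary terms
at the two endpoints, and these form the logarithm of a cross ratio: the integral is four times the
hyperbolic distance (`integral_abs_idealProj_sub`).

For a polygon inscribed in `∂K`, four times its length is thus the integral over `φ` of the
variation of the projected vertices. Since a line through `R` and an interior point meets `∂K` at
most twice, this variation is at most `2 w(φ)` (`IsBoundaryCurve.sum_abs_le`). A fine closed polygon
travels between near-extremal points and back, so its variation is also at least `2 w(φ) - 4ε`,
uniformly in `φ` (`IsBoundaryCurve.exists_partition`). Integrating both bounds gives the length `½ ∫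
w`. If `K` is a segment, `w` is the two-point integrand of its endpoints, and the formula is the
two-point formula doubled. -/

/-- The signed Euclidean coordinate, on the `φ`-normal, of the projection of `p` from the ideal
point with central angle `φ`. -/
noncomputable def idealProj (φ : ℝ) (p : Plane) : ℝ :=
  (p 1 * Real.cos φ - p 0 * Real.sin φ) / (1 - (p 0 * Real.cos φ + p 1 * Real.sin φ))

theorem linear_comb_lt_one {a b x y : ℝ} (h : a ^ 2 + b ^ 2 < 1) (hxy : x ^ 2 + y ^ 2 = 1) :
    0 < 1 - (a * x + b * y) := by
  nlinarith [sq_nonneg (a - x), sq_nonneg (b - y)]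

theorem one_sub_pos {p : Plane} (hp : ‖p‖ < 1) (φ : ℝ) :
    0 < 1 - (p 0 * Real.cos φ + p 1 * Real.sin φ) := by
  refine linear_comb_lt_one ?_ (Real.cos_sq_add_sin_sq φ)
  rw [← KleinDisk.aux_norm]
  nlinarith [norm_nonneg p]

/-- `idealProj` is the derivative, with respect to the angle, of `-log (1 - ⟪p, R⟫)`. -/
theorem hasDerivAt_neg_log {c a : ℝ} (h : c ^ 2 + a ^ 2 < 1) (ψ : ℝ) :
    HasDerivAt (fun ψ => -Real.log (1 - (c * Real.cos ψ + a * Real.sin ψ)))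
      ((a * Real.cos ψ - c * Real.sin ψ) / (1 - (c * Real.cos ψ + a * Real.sin ψ))) ψ := by
  have hpos := linear_comb_lt_one h (Real.cos_sq_add_sin_sq ψ)
  have h1 : HasDerivAt (fun ψ => 1 - (c * Real.cos ψ + a * Real.sin ψ))
      (-(c * (-Real.sin ψ) + a * Real.cos ψ)) ψ :=
    (((Real.hasDerivAt_cos ψ).const_mul c).add ((Real.hasDerivAt_sin ψ).const_mul a)).const_sub 1
  refine (h1.log hpos.ne').neg.congr_deriv ?_
  rw [← neg_div]
  congr 1
  ring

theorem continuous_div_one_sub {c a : ℝ} (h : c ^ 2 + a ^ 2 < 1) :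
    Continuous fun ψ =>
      (a * Real.cos ψ - c * Real.sin ψ) / (1 - (c * Real.cos ψ + a * Real.sin ψ)) :=
  Continuous.div (by fun_prop) (by fun_prop)
    fun ψ => (linear_comb_lt_one h (Real.cos_sq_add_sin_sq ψ)).ne'

/-- The factored numerator shows that, for `b ≤ a`, the sign is governed by `cos ψ - c`, which
vanishes exactly at the endpoints of the chord `x = c`. -/
theorem div_sub_div_eq {c a b : ℝ} (ha : c ^ 2 + a ^ 2 < 1) (hb : c ^ 2 + b ^ 2 < 1) (ψ : ℝ) :
    (a * Real.cos ψ - c * Real.sin ψ) / (1 - (c * Real.cos ψ + a * Real.sin ψ)) -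
      (b * Real.cos ψ - c * Real.sin ψ) / (1 - (c * Real.cos ψ + b * Real.sin ψ)) =
    (a - b) * (Real.cos ψ - c) /
      ((1 - (c * Real.cos ψ + a * Real.sin ψ)) * (1 - (c * Real.cos ψ + b * Real.sin ψ))) := by
  have h := Real.cos_sq_add_sin_sq ψ
  rw [div_sub_div _ _ (linear_comb_lt_one ha h).ne' (linear_comb_lt_one hb h).ne']
  congr 1
  linear_combination (-(a - b) * c) * h

/-- The two-point formula for `(c, a)` and `(c, b)` on the chord with endpoints `(c, ±s)`. The
integrand has constant sign on each of the two arcs cut off by the chord, and its antiderivative `G`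
is periodic, so both arcs contribute `G δ - G (-δ)`. -/
theorem integral_abs_eq {c a b s : ℝ} (hs : 0 < s) (hcs : c ^ 2 + s ^ 2 = 1)
    (ha : c ^ 2 + a ^ 2 < 1) (hb : c ^ 2 + b ^ 2 < 1) (hba : b ≤ a) (θ : ℝ) :
    ∫ ψ in θ..θ + 2 * Real.pi,
      |(a * Real.cos ψ - c * Real.sin ψ) / (1 - (c * Real.cos ψ + a * Real.sin ψ)) -
        (b * Real.cos ψ - c * Real.sin ψ) / (1 - (c * Real.cos ψ + b * Real.sin ψ))| =
      2 * Real.log ((s - b) * (s + a) / ((s - a) * (s + b))) := by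
  -- The endpoints of the chord have central angles `±δ`.
  obtain ⟨δ, hδ0, hδπ, hcos, hsin⟩ :
      ∃ δ, 0 < δ ∧ δ < Real.pi ∧ Real.cos δ = c ∧ Real.sin δ = s := by
    have h1 : -1 < c := by nlinarith
    have h2 : c < 1 := by nlinarith
    refine ⟨Real.arccos c, Real.arccos_pos.2 h2, ?_, Real.cos_arccos h1.le h2.le, ?_⟩
    · exact lt_of_le_of_ne (Real.arccos_le_pi c) fun h => by
        rw [Real.arccos_eq_pi] at h; linarith
    · rw [Real.sin_arccos, show 1 - c ^ 2 = s ^ 2 by linarith, Real.sqrt_sq hs.le]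
  have has := abs_lt_of_sq_lt_sq (show a ^ 2 < s ^ 2 by linarith) hs.le
  have hbs := abs_lt_of_sq_lt_sq (show b ^ 2 < s ^ 2 by linarith) hs.le
  rw [abs_lt] at has hbs
  set h : ℝ → ℝ := fun ψ =>
    (a * Real.cos ψ - c * Real.sin ψ) / (1 - (c * Real.cos ψ + a * Real.sin ψ)) -
      (b * Real.cos ψ - c * Real.sin ψ) / (1 - (c * Real.cos ψ + b * Real.sin ψ)) with hh
  set G : ℝ → ℝ := fun ψ => -Real.log (1 - (c * Real.cos ψ + a * Real.sin ψ)) -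
      -Real.log (1 - (c * Real.cos ψ + b * Real.sin ψ)) with hG
  have hcont : Continuous h := (continuous_div_one_sub ha).sub (continuous_div_one_sub hb)
  have hder : ∀ ψ, HasDerivAt G (h ψ) ψ := fun ψ =>
    (hasDerivAt_neg_log ha ψ).sub (hasDerivAt_neg_log hb ψ)
  have hper : Function.Periodic (fun ψ => |h ψ|) (2 * Real.pi) := fun ψ => by
    simp only [hh, Real.cos_add_two_pi, Real.sin_add_two_pi]
  have hint : ∀ x y, IntervalIntegrable (fun ψ => |h ψ|) volume x y := fun x y =>
    hcont.abs.intervalIntegrable x y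
  have hden : ∀ ψ, 0 < (1 - (c * Real.cos ψ + a * Real.sin ψ)) *
      (1 - (c * Real.cos ψ + b * Real.sin ψ)) := fun ψ =>
    mul_pos (linear_comb_lt_one ha (Real.cos_sq_add_sin_sq ψ))
      (linear_comb_lt_one hb (Real.cos_sq_add_sin_sq ψ))
  have h1 : ∫ ψ in (-δ)..δ, |h ψ| = G δ - G (-δ) := by
    rw [← intervalIntegral.integral_eq_sub_of_hasDerivAt (fun ψ _ => hder ψ)
      (hcont.intervalIntegrable _ _)]
    refine intervalIntegral.integral_congr fun ψ hψ => ?_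
    rw [uIcc_of_le (by linarith)] at hψ
    have : c ≤ Real.cos ψ := by
      rw [← hcos, ← Real.cos_abs ψ]
      exact Real.cos_le_cos_of_nonneg_of_le_pi (abs_nonneg _) hδπ.le (abs_le.2 hψ)
    refine abs_of_nonneg ?_
    simp only [hh]
    rw [div_sub_div_eq ha hb]
    exact div_nonneg (mul_nonneg (by linarith) (by linarith)) (hden ψ).le
  have h2 : ∫ ψ in δ..(-δ + 2 * Real.pi), |h ψ| = G δ - G (-δ + 2 * Real.pi) := by
    have : ∫ ψ in δ..(-δ + 2 * Real.pi), |h ψ| = ∫ ψ in δ..(-δ + 2 * Real.pi), -h ψ := by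
      refine intervalIntegral.integral_congr fun ψ hψ => ?_
      rw [uIcc_of_le (by linarith)] at hψ
      have : Real.cos ψ ≤ c := by
        have e : Real.cos ψ = -Real.cos |ψ - Real.pi| := by
          rw [Real.cos_abs, Real.cos_sub_pi, neg_neg]
        have e2 : c = -Real.cos (Real.pi - δ) := by rw [Real.cos_pi_sub, neg_neg, hcos]
        rw [e, e2]
        refine neg_le_neg (Real.cos_le_cos_of_nonneg_of_le_pi (abs_nonneg _) (by linarith) ?_)
        exact abs_le.2 ⟨by linarith [hψ.1], by linarith [hψ.2]⟩
      refine abs_of_nonpos ?_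
      simp only [hh]
      rw [div_sub_div_eq ha hb]
      exact div_nonpos_of_nonpos_of_nonneg
        (mul_nonpos_of_nonneg_of_nonpos (by linarith) (by linarith)) (hden ψ).le
    rw [this, intervalIntegral.integral_neg,
      intervalIntegral.integral_eq_sub_of_hasDerivAt (fun ψ _ => hder ψ)
      (hcont.intervalIntegrable _ _)]
    ring
  have hGδ : G δ - G (-δ) = Real.log ((s - b) * (s + a) / ((s - a) * (s + b))) := by
    -- At `±δ` each argument of a logarithm is `s` times a distance along the chord. The factors `s`
    -- cancel and leave the cross ratio.
    have e : ∀ x, 1 - (c * c + x * s) = s * (s - x) := fun x => by linear_combination -hcs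
    have e' : ∀ x, 1 - (c * c + x * -s) = s * (s + x) := fun x => by linear_combination -hcs
    have p1 : 0 < s - a := by linarith
    have p2 : 0 < s + a := by linarith
    have p3 : 0 < s - b := by linarith
    have p4 : 0 < s + b := by linarith
    simp only [hG, Real.cos_neg, Real.sin_neg, hcos, hsin, e, e']
    rw [Real.log_div (by positivity) (by positivity)]
    rw [Real.log_mul, Real.log_mul, Real.log_mul, Real.log_mul, Real.log_mul, Real.log_mul]
    · ring
    all_goals positivity
  have hG2 : G (-δ + 2 * Real.pi) = G (-δ) := by
    simp only [hG, Real.cos_add_two_pi, Real.sin_add_two_pi]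
  rw [hper.intervalIntegral_add_eq θ (-δ),
    ← intervalIntegral.integral_add_adjacent_intervals (hint (-δ) δ) (hint δ _), h1, h2, hG2, hGδ]
  ring

theorem exists_angle {x y : ℝ} (h : x ^ 2 + y ^ 2 = 1) :
    ∃ θ, Real.cos θ = x ∧ Real.sin θ = y := by
  have hn : ‖(⟨x, y⟩ : ℂ)‖ = 1 := by
    rw [← sq_eq_sq₀ (norm_nonneg _) zero_le_one, Complex.sq_norm, Complex.normSq_apply]
    simp only
    linarith
  have h0 : (⟨x, y⟩ : ℂ) ≠ 0 := by
    intro h'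
    rw [h', norm_zero] at hn
    exact zero_ne_one hn
  refine ⟨Complex.arg ⟨x, y⟩, ?_, ?_⟩
  · rw [Complex.cos_arg h0, hn, div_one]
  · rw [Complex.sin_arg, hn, div_one]

/-- Coordinates `a`, `b` along a chord of half-length `s` enter only through the three quantities in
`coshDist`. The formula then follows by comparing squares of hyperbolic cosines through the
double-angle formula. -/
theorem dist_eq_log {P Q : KleinDisk} {s a b : ℝ}
    (hP : 1 - ‖P.pt‖ ^ 2 = s ^ 2 - a ^ 2) (hQ : 1 - ‖Q.pt‖ ^ 2 = s ^ 2 - b ^ 2)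
    (hPQ : 1 - inner ℝ P.pt Q.pt = s ^ 2 - a * b) (hs : 0 < s) (hba : b ≤ a) :
    dist P Q = 1 / 2 * Real.log ((s - b) * (s + a) / ((s - a) * (s + b))) := by
  have ha := KleinDisk.aux_pos P
  have hb := KleinDisk.aux_pos Q
  have has := abs_lt_of_sq_lt_sq (show a ^ 2 < s ^ 2 by linarith) hs.le
  have hbs := abs_lt_of_sq_lt_sq (show b ^ 2 < s ^ 2 by linarith) hs.le
  rw [abs_lt] at has hbs
  have p1 : 0 < s - a := by linarith
  have p2 : 0 < s + a := by linarith
  have p3 : 0 < s - b := by linarith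
  have p4 : 0 < s + b := by linarith
  set x : ℝ := (s - b) * (s + a) / ((s - a) * (s + b)) with hx
  have hx0 : 0 < x := by positivity
  have hx1 : 1 ≤ x := by
    rw [hx, one_le_div (by positivity)]
    nlinarith
  have hlog : 0 ≤ 1 / 2 * Real.log x := by
    have := Real.log_nonneg hx1
    positivity
  have hcosh : KleinDisk.coshDist P Q = Real.cosh (1 / 2 * Real.log x) := by
    refine (pow_left_inj₀ (KleinDisk.coshDist_pos P Q).le (Real.cosh_pos _).le two_ne_zero).1 ?_
    have h2 := Real.cosh_two_mul (1 / 2 * Real.log x)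
    have h3 := Real.cosh_sq_sub_sinh_sq (1 / 2 * Real.log x)
    rw [show 2 * (1 / 2 * Real.log x) = Real.log x by ring, Real.cosh_log hx0] at h2
    have h4 : Real.cosh (1 / 2 * Real.log x) ^ 2 = ((x + x⁻¹) / 2 + 1) / 2 := by linarith
    rw [h4, KleinDisk.coshDist_sq, hP, hQ, hPQ, hx,
      show s ^ 2 - a ^ 2 = (s - a) * (s + a) by ring,
      show s ^ 2 - b ^ 2 = (s - b) * (s + b) by ring]
    field_simp
    ring
  rw [KleinDisk.dist_def, hcosh, Real.arcosh_cosh hlog]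

/-- The hyperbolic distance of two points is a Cauchy-type integral of the lengths of the
projections of the segment joining them. -/
theorem integral_abs_idealProj_sub (P Q : KleinDisk) :
    ∫ φ in (0 : ℝ)..2 * Real.pi, |idealProj φ P.pt - idealProj φ Q.pt| = 4 * dist P Q := by
  rcases eq_or_ne P Q with rfl | hne
  · simp
  have hd : 0 < (P.pt 0 - Q.pt 0) ^ 2 + (P.pt 1 - Q.pt 1) ^ 2 := by
    refine lt_of_le_of_ne (by positivity) fun h => hne ?_
    have e0 : P.pt 0 - Q.pt 0 = 0 := by
      nlinarith [sq_nonneg (P.pt 0 - Q.pt 0), sq_nonneg (P.pt 1 - Q.pt 1)]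
    have e1 : P.pt 1 - Q.pt 1 = 0 := by
      nlinarith [sq_nonneg (P.pt 0 - Q.pt 0), sq_nonneg (P.pt 1 - Q.pt 1)]
    ext i
    fin_cases i
    · exact sub_eq_zero.1 e0
    · exact sub_eq_zero.1 e1
  set r := √((P.pt 0 - Q.pt 0) ^ 2 + (P.pt 1 - Q.pt 1) ^ 2) with hr
  have hr0 : 0 < r := Real.sqrt_pos.2 hd
  have hr2 : r ^ 2 = (P.pt 0 - Q.pt 0) ^ 2 + (P.pt 1 - Q.pt 1) ^ 2 := Real.sq_sqrt hd.le
  -- `θ` is the direction normal to `PQ` for which `P - Q = r (-sin θ, cos θ)`. Rotating by `-θ`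
  -- puts both points on the line `x = c`, with `P` above `Q`.
  obtain ⟨θ, hcθ, hsθ⟩ := exists_angle (x := (P.pt 1 - Q.pt 1) / r) (y := -(P.pt 0 - Q.pt 0) / r)
    (by field_simp; linarith)
  have hcs := Real.cos_sq_add_sin_sq θ
  have h1 : P.pt 1 - Q.pt 1 = r * Real.cos θ := by rw [hcθ]; field_simp
  have h0 : P.pt 0 - Q.pt 0 = -(r * Real.sin θ) := by rw [hsθ]; field_simp
  obtain ⟨c, a, b, hba, P0, P1, Q0, Q1⟩ : ∃ c a b : ℝ, b ≤ a ∧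
      P.pt 0 = c * Real.cos θ - a * Real.sin θ ∧ P.pt 1 = c * Real.sin θ + a * Real.cos θ ∧
      Q.pt 0 = c * Real.cos θ - b * Real.sin θ ∧ Q.pt 1 = c * Real.sin θ + b * Real.cos θ := by
    refine ⟨P.pt 0 * Real.cos θ + P.pt 1 * Real.sin θ, P.pt 1 * Real.cos θ - P.pt 0 * Real.sin θ,
      P.pt 1 * Real.cos θ - P.pt 0 * Real.sin θ - r, by linarith, ?_, ?_, ?_, ?_⟩
    · linear_combination (-P.pt 0) * hcs
    · linear_combination (-P.pt 1) * hcs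
    · linear_combination (-P.pt 0) * hcs - h0
    · linear_combination (-P.pt 1) * hcs - h1
  have nP : ‖P.pt‖ ^ 2 = c ^ 2 + a ^ 2 := by
    rw [KleinDisk.aux_norm, P0, P1]; linear_combination (c ^ 2 + a ^ 2) * hcs
  have nQ : ‖Q.pt‖ ^ 2 = c ^ 2 + b ^ 2 := by
    rw [KleinDisk.aux_norm, Q0, Q1]; linear_combination (c ^ 2 + b ^ 2) * hcs
  have nPQ : inner ℝ P.pt Q.pt = c ^ 2 + a * b := by
    rw [KleinDisk.aux_inner, P0, P1, Q0, Q1]; linear_combination (c ^ 2 + a * b) * hcs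
  have ha := KleinDisk.aux_pos P
  have hb := KleinDisk.aux_pos Q
  have hc1 : 0 < 1 - c ^ 2 := by nlinarith [sq_nonneg a]
  have hs0 : 0 < √(1 - c ^ 2) := Real.sqrt_pos.2 hc1
  have hs2 := Real.sq_sqrt hc1.le
  rw [dist_eq_log (s := √(1 - c ^ 2)) (a := a) (b := b) (by rw [nP, hs2]; ring)
    (by rw [nQ, hs2]; ring) (by rw [nPQ, hs2]; ring) hs0 hba]
  have key := integral_abs_eq (c := c) (a := a) (b := b) hs0 (by rw [hs2]; ring) (by linarith) (by linarith) hba (0 - θ)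
  have e : ∀ x φ : ℝ, ∀ p : Plane, p 0 = c * Real.cos θ - x * Real.sin θ →
      p 1 = c * Real.sin θ + x * Real.cos θ → idealProj φ p =
        (x * Real.cos (φ - θ) - c * Real.sin (φ - θ)) /
          (1 - (c * Real.cos (φ - θ) + x * Real.sin (φ - θ))) := by
    intro x φ p hp0 hp1
    rw [idealProj, hp0, hp1, Real.cos_sub, Real.sin_sub]
    congr 1
    · ring
    · ring
  have := intervalIntegral.integral_comp_sub_right (a := 0) (b := 2 * Real.pi) (fun ψ =>
      |(a * Real.cos ψ - c * Real.sin ψ) / (1 - (c * Real.cos ψ + a * Real.sin ψ)) -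
        (b * Real.cos ψ - c * Real.sin ψ) / (1 - (c * Real.cos ψ + b * Real.sin ψ))|) θ
  simp only [e a _ P.pt P0 P1, e b _ Q.pt Q0 Q1]
  rw [this, show 2 * Real.pi - θ = 0 - θ + 2 * Real.pi by ring, key]
  ring

/-! ### The projected width as an oscillation -/

/-- The unit vector spanning the `φ`-normal. -/
noncomputable def normalDirection (φ : ℝ) : Plane := !₂[-Real.sin φ, Real.cos φ]

theorem norm_normalDirection (φ : ℝ) : ‖normalDirection φ‖ = 1 := by
  rw [← sq_eq_sq₀ (norm_nonneg _) zero_le_one, KleinDisk.aux_norm]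
  simp [normalDirection]

/-- Since `|R| = 1`, the point `R + r (p - R)` is orthogonal to `R` exactly when `r (1 - ⟪p, R⟫) =
1`. For `p` in the open disk this has exactly one solution `r`. -/
theorem projectionFromIdeal_eq_image {K : Set Plane} (hK : K ⊆ ball 0 1) (φ : ℝ) :
    projectionFromIdeal K φ = (fun p => idealProj φ p • normalDirection φ) '' K := by
  have hcs := Real.cos_sq_add_sin_sq φ
  have hline : ∀ (p : Plane) (r : ℝ),
      AffineMap.lineMap (idealPoint φ) p r 0 = Real.cos φ + r * (p 0 - Real.cos φ) ∧
      AffineMap.lineMap (idealPoint φ) p r 1 = Real.sin φ + r * (p 1 - Real.sin φ) := by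
    intro p r
    constructor <;> simp [AffineMap.lineMap_apply, idealPoint] <;> ring
  have key : ∀ (p : Plane) (r : ℝ), r * (1 - (p 0 * Real.cos φ + p 1 * Real.sin φ)) = 1 →
      AffineMap.lineMap (idealPoint φ) p r = idealProj φ p • normalDirection φ := by
    intro p r hr
    have hne : 1 - (p 0 * Real.cos φ + p 1 * Real.sin φ) ≠ 0 := right_ne_zero_of_mul_eq_one hr
    have e : idealProj φ p = (p 1 * Real.cos φ - p 0 * Real.sin φ) * r := by
      rw [idealProj, div_eq_iff hne]
      linear_combination (-(p 1 * Real.cos φ - p 0 * Real.sin φ)) * hr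
    rw [e]
    ext i
    fin_cases i
    · simp only [Fin.zero_eta, (hline p r).1]
      simp [normalDirection]
      linear_combination (-Real.cos φ) * hr - r * p 0 * hcs
    · simp only [Fin.mk_one, (hline p r).2]
      simp [normalDirection]
      linear_combination (-Real.sin φ) * hr - r * p 1 * hcs
  ext x
  constructor
  · rintro ⟨hx, p, hp, hxp⟩
    obtain ⟨r, rfl⟩ := mem_affineSpan_pair_iff_exists_lineMap_eq.1 hxp
    refine ⟨p, hp, (key p r ?_).symm⟩
    rw [phiNormal, mem_ofPred_eq, KleinDisk.aux_inner, (hline p r).1, (hline p r).2] at hx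
    simp [idealPoint] at hx
    linear_combination (1 - r) * hcs - hx
  · rintro ⟨p, hp, rfl⟩
    have hne := one_sub_pos (mem_ball_zero_iff.1 (hK hp)) φ
    refine ⟨?_, p, hp, ?_⟩
    · rw [phiNormal, mem_ofPred_eq, KleinDisk.aux_inner]
      simp [normalDirection, idealPoint]
      ring
    · refine mem_affineSpan_pair_iff_exists_lineMap_eq.2 ⟨_, key p _ (inv_mul_cancel₀ hne.ne')⟩

theorem dist_smul_normalDirection (φ x y : ℝ) :
    dist (x • normalDirection φ) (y • normalDirection φ) = |x - y| := by
  rw [dist_eq_norm, ← sub_smul, norm_smul, norm_normalDirection, mul_one, Real.norm_eq_abs]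

theorem continuous_uncurry_idealProj {α : Type*} [TopologicalSpace α] {f : α → ℝ} {g : α → Plane}
    (hf : Continuous f) (hg : Continuous g) (h : ∀ x, ‖g x‖ < 1) :
    Continuous fun x => idealProj (f x) (g x) :=
  Continuous.div (by fun_prop) (by fun_prop) fun x => (one_sub_pos (h x) (f x)).ne'

theorem continuousOn_uncurry_idealProj {α : Type*} [TopologicalSpace α] {f : α → ℝ} {g : α → Plane}
    {s : Set α} (hf : ContinuousOn f s) (hg : ContinuousOn g s) (h : ∀ x ∈ s, ‖g x‖ < 1) :
    ContinuousOn (fun x => idealProj (f x) (g x)) s := by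
  rw [continuousOn_iff_continuous_domRestrict] at *
  exact continuous_uncurry_idealProj hf hg fun x => h x x.2

theorem isCompact_projectionFromIdeal {K : Set Plane} (hc : IsCompact K) (hK : K ⊆ ball 0 1)
    (φ : ℝ) : IsCompact (projectionFromIdeal K φ) := by
  rw [projectionFromIdeal_eq_image hK]
  have h : ContinuousOn (fun p => idealProj φ p) K :=
    continuousOn_uncurry_idealProj continuousOn_const continuousOn_id
      fun x hx => mem_ball_zero_iff.1 (hK hx)
  exact hc.image_of_continuousOn (h.smul continuousOn_const)

theorem abs_idealProj_sub_le {K : Set Plane} (hc : IsCompact K) (hK : K ⊆ ball 0 1) (φ : ℝ)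
    {p q : Plane} (hp : p ∈ K) (hq : q ∈ K) :
    |idealProj φ p - idealProj φ q| ≤ projectedWidth K φ := by
  rw [← dist_smul_normalDirection]
  refine dist_le_diam_of_mem (isCompact_projectionFromIdeal hc hK φ).isBounded ?_ ?_
  · rw [projectionFromIdeal_eq_image hK]; exact mem_image_of_mem _ hp
  · rw [projectionFromIdeal_eq_image hK]; exact mem_image_of_mem _ hq

/-- The projected width is the difference of the maximum and the minimum of `idealProj`. -/
theorem exists_projectedWidth_eq {K : Set Plane} (hc : IsCompact K) (hn : K.Nonempty)
    (hK : K ⊆ ball 0 1) (φ : ℝ) :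
    ∃ p ∈ K, ∃ q ∈ K, projectedWidth K φ = idealProj φ p - idealProj φ q ∧
      ∀ x ∈ K, idealProj φ x ∈ Icc (idealProj φ q) (idealProj φ p) := by
  have hcont : ContinuousOn (idealProj φ) K :=
    continuousOn_uncurry_idealProj continuousOn_const continuousOn_id
      fun x hx => mem_ball_zero_iff.1 (hK hx)
  obtain ⟨p, hp, hpmax⟩ := hc.exists_isMaxOn hn hcont
  obtain ⟨q, hq, hqmin⟩ := hc.exists_isMinOn hn hcont
  have hI : ∀ x ∈ K, idealProj φ x ∈ Icc (idealProj φ q) (idealProj φ p) :=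
    fun x hx => ⟨hqmin hx, hpmax hx⟩
  refine ⟨p, hp, q, hq, le_antisymm ?_ ((le_abs_self _).trans
    (abs_idealProj_sub_le hc hK φ hp hq)), hI⟩
  refine diam_le_of_forall_dist_le (sub_nonneg.2 (hI p hp).1) ?_
  rw [projectionFromIdeal_eq_image hK]
  rintro _ ⟨x, hx, rfl⟩ _ ⟨y, hy, rfl⟩
  simp only [dist_smul_normalDirection]
  have h1 := hI x hx
  have h2 := hI y hy
  exact abs_le.2 ⟨by linarith [h1.1, h2.2], by linarith [h1.2, h2.1]⟩

/-- The width is the supremum over the compact set `K × K` of a jointly continuous function. -/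
theorem continuous_projectedWidth {K : Set Plane} (hc : IsCompact K) (hn : K.Nonempty)
    (hK : K ⊆ ball 0 1) : Continuous (projectedWidth K) := by
  have := isCompact_iff_compactSpace.1 hc
  have hcont : Continuous fun x : ℝ × (K × K) => idealProj x.1 x.2.1 - idealProj x.1 x.2.2 :=
    (continuous_uncurry_idealProj (g := fun x : ℝ × (K × K) => (x.2.1 : Plane)) continuous_fst
      (by fun_prop) fun x => mem_ball_zero_iff.1 (hK x.2.1.2)).sub
    (continuous_uncurry_idealProj (g := fun x : ℝ × (K × K) => (x.2.2 : Plane)) continuous_fst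
      (by fun_prop) fun x => mem_ball_zero_iff.1 (hK x.2.2.2))
  convert (isCompact_univ (X := K × K)).continuous_sSup
    (f := fun φ (x : K × K) => idealProj φ x.1 - idealProj φ x.2) hcont with φ
  obtain ⟨p, hp, q, hq, hw, hI⟩ := exists_projectedWidth_eq hc hn hK φ
  symm
  refine IsGreatest.csSup_eq ⟨⟨((⟨p, hp⟩ : K), (⟨q, hq⟩ : K)), mem_univ _, hw.symm⟩, ?_⟩
  rintro _ ⟨⟨x, y⟩, -, rfl⟩
  rw [hw]
  exact sub_le_sub (hI x x.2).2 (hI y y.2).1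

theorem continuous_abs_idealProj_sub (p q : KleinDisk) :
    Continuous fun φ => |idealProj φ p.pt - idealProj φ q.pt| :=
  ((continuous_uncurry_idealProj continuous_id continuous_const fun _ => p.norm_lt_one).sub
    (continuous_uncurry_idealProj continuous_id continuous_const fun _ => q.norm_lt_one)).abs

/-! ### Real functions and sequences -/

/-- A closed sequence goes from `a i` to `a j` and returns by way of `a n = a 0`; each of the two
trips costs at least `|a i - a j|`. -/
theorem two_mul_abs_sub_le_sum {a : ℕ → ℝ} {n i j : ℕ} (hi : i ≤ n) (hj : j ≤ n)
    (h : a n = a 0) : 2 * |a i - a j| ≤ ∑ k ∈ Finset.range n, |a (k + 1) - a k| := by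
  wlog hij : i ≤ j generalizing i j
  · rw [abs_sub_comm]; exact this hj hi (by omega)
  have hle : ∀ m n : ℕ, m ≤ n → |a m - a n| ≤ ∑ k ∈ Finset.Ico m n, |a (k + 1) - a k| := by
    intro m n hmn
    have := dist_le_Ico_sum_dist a hmn
    simpa only [Real.dist_eq, abs_sub_comm (a (_ + 1))] using this
  rw [Finset.range_eq_Ico, ← Finset.sum_Ico_consecutive _ (Nat.zero_le i) hi,
    ← Finset.sum_Ico_consecutive _ hij hj]
  have h1 := hle 0 i (Nat.zero_le _)
  have h2 := hle i j hij
  have h3 := hle j n hj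
  rw [h] at h3
  have h4 := abs_sub_le (a i) (a 0) (a j)
  rw [abs_sub_comm (a i) (a 0), abs_sub_comm (a 0) (a j)] at h4
  linarith

/-- A function whose nonextremal level sets have at most two points has variation at most twice
its oscillation. -/
theorem sum_abs_sub_le_of_level_sets {g : ℝ → ℝ} (hg : ContinuousOn g (Icc 0 1)) {m M : ℝ}
    (hmM : ∀ t ∈ Icc (0 : ℝ) 1, g t ∈ Icc m M)
    (hlev : ∀ y ∈ Ioo m M, ∃ σ : ℝ → Bool, InjOn σ {t ∈ Ioo (0 : ℝ) 1 | g t = y})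
    {u : ℕ → ℝ} (hu : Monotone u) (huI : ∀ i, u i ∈ Icc (0 : ℝ) 1) (n : ℕ) :
    ∑ i ∈ Finset.range n, |g (u (i + 1)) - g (u i)| ≤ 2 * (M - m) := by
  have hmM' : m ≤ M := (hmM _ (huI 0)).1.trans (hmM _ (huI 0)).2
  -- Banach indicatrix: each increment is the measure of the interval it spans, so the sum is the
  -- integral over `y` of the number of such intervals containing `y`. It suffices to bound this
  -- number by two for almost every `y`.
  have key : ∑ i ∈ Finset.range n, volume (uIoo (g (u i)) (g (u (i + 1)))) ≤
      2 * volume (Ioo m M) := by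
    have hmeas : ∀ i, MeasurableSet (uIoo (g (u i)) (g (u (i + 1)))) := fun i => measurableSet_Ioo
    have e1 : ∀ i, volume (uIoo (g (u i)) (g (u (i + 1)))) =
        ∫⁻ y, (uIoo (g (u i)) (g (u (i + 1)))).indicator 1 y :=
      fun i => (lintegral_indicator_one (hmeas i)).symm
    have e2 : 2 * volume (Ioo m M) = ∫⁻ y, 2 * (Ioo m M).indicator 1 y := by
      rw [lintegral_const_mul _ (measurable_one.indicator measurableSet_Ioo),
        lintegral_indicator_one measurableSet_Ioo]
    simp only [e1]
    rw [e2, ← lintegral_finsetSum _ fun i _ => measurable_one.indicator (hmeas i)]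
    have hfin : (range fun i => g (u i)).Countable := countable_range _
    refine lintegral_mono_ae ?_
    -- Discarding the countably many values at nodes forces each crossing of `y` into the open
    -- interval between consecutive nodes. Crossings of different intervals are then distinct, and
    -- none occurs at `0` or `1`.
    filter_upwards [hfin.ae_notMem volume] with y hy
    have hne : ∀ i, g (u i) ≠ y := fun i h => hy ⟨i, h⟩
    classical
    have hsum : ∑ i ∈ Finset.range n, (uIoo (g (u i)) (g (u (i + 1)))).indicator (1 : ℝ → ℝ≥0∞) y =
        (((Finset.range n).filter fun i => y ∈ uIoo (g (u i)) (g (u (i + 1)))).card : ℝ≥0∞) := by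
      rw [Finset.card_filter]
      push_cast
      exact Finset.sum_congr rfl fun i _ => by simp [indicator_apply]
    rw [hsum]
    by_cases hyI : y ∈ Ioo m M
    · rw [indicator_of_mem hyI, Pi.one_apply, mul_one]
      obtain ⟨σ, hσ⟩ := hlev y hyI
      have hex : ∀ i, y ∈ uIoo (g (u i)) (g (u (i + 1))) →
          ∃ t ∈ Ioo (u i) (u (i + 1)), g t = y := by
        intro i hi
        have hle := hu (Nat.le_succ i)
        have hsub : uIcc (u i) (u (i + 1)) ⊆ Icc 0 1 := by
          rw [uIcc_of_le hle]
          exact Icc_subset_Icc (huI i).1 (huI (i + 1)).2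
        obtain ⟨t, ht, hty⟩ := intermediate_value_uIcc (hg.mono hsub) (Ioo_subset_Icc_self hi)
        rw [uIcc_of_le hle] at ht
        refine ⟨t, ⟨lt_of_le_of_ne ht.1 ?_, lt_of_le_of_ne ht.2 ?_⟩, hty⟩
        · rintro rfl; exact hne _ hty
        · rintro rfl; exact hne _ hty
      choose! τ hτ hτy using hex
      have hcard : ((Finset.range n).filter fun i => y ∈ uIoo (g (u i)) (g (u (i + 1)))).card ≤
          (Finset.univ : Finset Bool).card := by
        refine Finset.card_le_card_of_injOn (σ ∘ τ) (fun _ _ => Finset.mem_univ _) ?_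
        intro i hi j hj hij
        replace hi := (Finset.mem_filter.1 (Finset.mem_coe.1 hi)).2
        replace hj := (Finset.mem_filter.1 (Finset.mem_coe.1 hj)).2
        have hmem : ∀ i, y ∈ uIoo (g (u i)) (g (u (i + 1))) →
            τ i ∈ {t ∈ Ioo (0 : ℝ) 1 | g t = y} := fun i hi =>
          ⟨⟨(huI i).1.trans_lt (hτ i hi).1, (hτ i hi).2.trans_le (huI (i + 1)).2⟩, hτy i hi⟩
        have hlt : ∀ i j, y ∈ uIoo (g (u i)) (g (u (i + 1))) →
            y ∈ uIoo (g (u j)) (g (u (j + 1))) → i < j → τ i < τ j := fun i j hi hj h =>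
          (hτ i hi).2.trans_le ((hu (Nat.succ_le_of_lt h)).trans (hτ j hj).1.le)
        have heq : τ i = τ j := hσ (hmem i hi) (hmem j hj) hij
        rcases lt_trichotomy i j with h | h | h
        · exact absurd heq (hlt i j hi hj h).ne
        · exact h
        · exact absurd heq (hlt j i hj hi h).ne'
      rw [Finset.card_univ, Fintype.card_bool] at hcard
      exact_mod_cast hcard
    · have : ((Finset.range n).filter fun i => y ∈ uIoo (g (u i)) (g (u (i + 1)))) = ∅ := by
        refine Finset.filter_eq_empty_iff.2 fun i _ hi => hyI ?_
        have h1 := hmM _ (huI i)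
        have h2 := hmM _ (huI (i + 1))
        exact ⟨(le_min h1.1 h2.1).trans_lt hi.1, hi.2.trans_le (max_le h1.2 h2.2)⟩
      rw [this]
      simp
  simp only [Real.volume_uIoo, Real.volume_Ioo] at key
  rw [← ENNReal.ofReal_sum_of_nonneg fun i _ => abs_nonneg _,
    show (2 : ℝ≥0∞) = ENNReal.ofReal 2 by simp, ← ENNReal.ofReal_mul zero_le_two] at key
  exact (ENNReal.ofReal_le_ofReal_iff (mul_nonneg zero_le_two (sub_nonneg.2 hmM'))).1 key

/-! ### Boundary points of a convex body -/

theorem Convex.mem_interior_of_sub_eq_smul {E : Type*} [AddCommGroup E] [TopologicalSpace E]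
    [IsTopologicalAddGroup E] [Module ℝ E] [ContinuousConstSMul ℝ E]
    {K : Set E} (hK : Convex ℝ K) {x z w : E} {r : ℝ} (hz : z ∈ interior K) (hw : w ∈ K)
    (hr0 : 0 < r) (hr1 : r < 1) (hx : x - z = r • (w - z)) : x ∈ interior K := by
  refine hK.openSegment_interior_self_subset_interior hz hw
    ⟨1 - r, r, by linarith, hr0, by ring, ?_⟩
  rw [sub_eq_iff_eq_add.1 hx, sub_smul, one_smul, smul_sub]
  abel

/-- A ray from an interior point meets the boundary of a convex set only once. -/
theorem Convex.eq_of_mem_frontier_of_same_side {E : Type*} [AddCommGroup E] [TopologicalSpace E]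
    [IsTopologicalAddGroup E] [Module ℝ E] [ContinuousConstSMul ℝ E]
    {K : Set E} (hK : Convex ℝ K) (hcl : IsClosed K) {x y z v : E} {r s : ℝ} (hz : z ∈ interior K)
    (hx : x ∈ frontier K) (hy : y ∈ frontier K) (hxz : x - z = r • v) (hyz : y - z = s • v)
    (hrs : 0 < r * s) : x = y := by
  -- If `r / s < 1`, then `x` lies strictly between `z` and `y` and is interior. Exchanging `x` and
  -- `y` leaves only `r = s`.
  have main : ∀ {x y : E} {r s : ℝ}, x ∈ frontier K → y ∈ frontier K → x - z = r • v →
      y - z = s • v → 0 < r * s → ¬ r / s < 1 := by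
    intro x y r s hx hy hxz hyz hrs hlt
    have hs : s ≠ 0 := right_ne_zero_of_mul hrs.ne'
    refine hx.2 (hK.mem_interior_of_sub_eq_smul hz (hcl.frontier_subset hy)
      (r := r / s) ?_ hlt ?_)
    · rw [div_eq_mul_inv, ← mul_self_div_self s⁻¹]
      have : 0 < s * s := mul_self_pos.2 hs
      rw [show r * (s⁻¹ * s⁻¹ / s⁻¹) = r * s / (s * s) by field_simp]
      positivity
    · rw [hyz, smul_smul, div_mul_cancel₀ _ hs, hxz]
  have hs : s ≠ 0 := right_ne_zero_of_mul hrs.ne'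
  have hr : r ≠ 0 := left_ne_zero_of_mul hrs.ne'
  have h1 := not_lt.1 (main hx hy hxz hyz hrs)
  have h2 := not_lt.1 (main hy hx hyz hxz (by rwa [mul_comm]))
  have hpos : 0 < r / s := by linarith
  have h3 : r / s = 1 := by
    refine le_antisymm ?_ h1
    rw [← inv_div, one_le_inv₀ hpos] at h2
    exact h2
  have : r = s := by rwa [div_eq_one_iff_eq hs] at h3
  rw [← sub_left_inj (a := z), hxz, hyz, this]

/-- Clearing the positive denominator turns `idealProj φ x = y` into the affine equation `l x = 0`,
with `l q < 0 < l p`. From any interior point, moving toward whichever of `p`, `q` has the opposite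
sign reaches a zero before leaving the interior. -/
theorem exists_mem_interior_idealProj_eq {K : Set Plane} (hconv : Convex ℝ K) (hK : K ⊆ ball 0 1)
    (hint : (interior K).Nonempty) {φ y : ℝ} {p q : Plane} (hp : p ∈ K) (hq : q ∈ K)
    (hy : y ∈ Ioo (idealProj φ q) (idealProj φ p)) : ∃ z ∈ interior K, idealProj φ z = y := by
  set l : Plane → ℝ := fun x =>
    x 1 * Real.cos φ - x 0 * Real.sin φ - y * (1 - (x 0 * Real.cos φ + x 1 * Real.sin φ)) with hl
  have hpos : ∀ x ∈ K, 0 < 1 - (x 0 * Real.cos φ + x 1 * Real.sin φ) := fun x hx =>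
    one_sub_pos (mem_ball_zero_iff.1 (hK hx)) φ
  have hlp : 0 < l p := by
    have := (lt_div_iff₀ (hpos p hp)).1 hy.2
    simp only [hl]; linarith
  have hlq : l q < 0 := by
    have := (div_lt_iff₀ (hpos q hq)).1 hy.1
    simp only [hl]; linarith
  suffices ∃ z ∈ interior K, l z = 0 by
    obtain ⟨z, hz, hz0⟩ := this
    refine ⟨z, hz, ?_⟩
    rw [idealProj, div_eq_iff (hpos z (interior_subset hz)).ne']
    simp only [hl] at hz0
    linarith
  have step : ∀ z ∈ interior K, ∀ w ∈ K, l z * l w < 0 → ∃ z ∈ interior K, l z = 0 := by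
    intro z hz w hw hzw
    have hne : l z - l w ≠ 0 := fun h => by
      rw [sub_eq_zero.1 h] at hzw; nlinarith [mul_self_nonneg (l w)]
    have hr0 : 0 < l z / (l z - l w) := by
      have : l z / (l z - l w) = (l z * l z - l z * l w) / (l z - l w) ^ 2 := by field_simp
      rw [this]
      exact div_pos (by nlinarith [mul_self_nonneg (l z)]) (by positivity)
    have hr1 : 0 < 1 - l z / (l z - l w) := by
      have : 1 - l z / (l z - l w) = (l w * l w - l z * l w) / (l z - l w) ^ 2 := by
        field_simp; ring
      rw [this]
      exact div_pos (by nlinarith [mul_self_nonneg (l w)]) (by positivity)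
    refine ⟨z + (l z / (l z - l w)) • (w - z), hconv.mem_interior_of_sub_eq_smul hz hw hr0
      (by linarith) (add_sub_cancel_left _ _), ?_⟩
    have : ∀ r : ℝ, l (z + r • (w - z)) = l z - r * (l z - l w) := by
      intro r
      simp [hl]
      ring
    rw [this, div_mul_cancel₀ _ hne, sub_self]
  obtain ⟨z, hz⟩ := hint
  rcases lt_trichotomy (l z) 0 with h | h | h
  · exact step z hz p hp (by nlinarith)
  · exact ⟨z, hz, h⟩
  · exact step z hz q hq (by nlinarith)

/-- A line through an interior point and an ideal point meets the boundary at most twice. -/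
theorem exists_injOn_frontier_idealProj_eq {K : Set Plane} (hconv : Convex ℝ K) (hcl : IsClosed K)
    (hK : K ⊆ ball 0 1) (hint : (interior K).Nonempty) {φ y : ℝ} {p q : Plane} (hp : p ∈ K)
    (hq : q ∈ K) (hy : y ∈ Ioo (idealProj φ q) (idealProj φ p)) :
    ∃ σ : Plane → Bool, InjOn σ {x ∈ frontier K | idealProj φ x = y} := by
  obtain ⟨z, hz, hzy⟩ := exists_mem_interior_idealProj_eq hconv hK hint hp hq hy
  have hlin : ∀ x ∈ K, idealProj φ x = y →
      x 1 * Real.cos φ - x 0 * Real.sin φ = y * (1 - (x 0 * Real.cos φ + x 1 * Real.sin φ)) :=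
    fun x hx h => (div_eq_iff (one_sub_pos (mem_ball_zero_iff.1 (hK hx)) φ).ne').1 h
  -- `v = y • normalDirection φ - R` directs the line through `R` with projection `y`, and `‖v‖² = 1
  -- + y²`. So `s x` is the coordinate of `x - z` along `v`, and its sign tells on which side of `z`
  -- the point lies.
  set v : Plane := !₂[-(Real.cos φ + y * Real.sin φ), y * Real.cos φ - Real.sin φ] with hv
  set s : Plane → ℝ := fun x => ((x 0 - z 0) * -(Real.cos φ + y * Real.sin φ) +
    (x 1 - z 1) * (y * Real.cos φ - Real.sin φ)) / (1 + y ^ 2) with hs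
  have hcs := Real.cos_sq_add_sin_sq φ
  have hsv : ∀ x ∈ frontier K, idealProj φ x = y → x - z = s x • v := by
    intro x hx hxy
    have h1 := hlin x (hcl.frontier_subset hx) hxy
    have h2 := hlin z (interior_subset hz) hzy
    have hy0 : (1 + y ^ 2) ≠ 0 := by positivity
    ext i
    fin_cases i
    · simp [hs, hv]
      field_simp
      linear_combination (y * Real.cos φ - Real.sin φ) * (h1 - h2) -
        ((x 0 - z 0) * (1 + y ^ 2)) * hcs
    · simp [hs, hv]
      field_simp
      linear_combination (y * Real.sin φ + Real.cos φ) * (h1 - h2) -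
        ((x 1 - z 1) * (1 + y ^ 2)) * hcs
  have hs0 : ∀ x ∈ frontier K, idealProj φ x = y → s x ≠ 0 := by
    intro x hx hxy h0
    have := hsv x hx hxy
    rw [h0, zero_smul, sub_eq_zero] at this
    rw [this] at hx
    exact hx.2 hz
  refine ⟨fun x => decide (0 < s x), ?_⟩
  rintro a ⟨ha, hay⟩ b ⟨hb, hby⟩ hab
  refine hconv.eq_of_mem_frontier_of_same_side hcl hz ha hb (hsv a ha hay) (hsv b hb hby) ?_
  have ha0 := hs0 a ha hay
  have hb0 := hs0 b hb hby
  have hiff : 0 < s a ↔ 0 < s b := by simpa using hab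
  rcases ha0.lt_or_gt with h | h
  · exact mul_pos_of_neg_of_neg h
      (lt_of_le_of_ne (not_lt.1 fun h' => lt_asymm h (hiff.2 h')) hb0)
  · exact mul_pos h (hiff.1 h)

/-- Moving `p` along its line through `R` multiplies numerator and denominator by the same factor `1
- r`. -/
theorem idealProj_add_smul_idealPoint_sub {φ r : ℝ} (hr : r ≠ 1) (p : Plane) :
    idealProj φ (p + r • (idealPoint φ - p)) = idealProj φ p := by
  have hcs := Real.cos_sq_add_sin_sq φ
  have e0 : (p + r • (idealPoint φ - p)) 0 = p 0 + r * (Real.cos φ - p 0) := by simp [idealPoint]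
  have e1 : (p + r • (idealPoint φ - p)) 1 = p 1 + r * (Real.sin φ - p 1) := by simp [idealPoint]
  have hr' : 1 - r ≠ 0 := sub_ne_zero.2 hr.symm
  rw [idealProj, idealProj, e0, e1, 
    ← mul_div_mul_left (p 1 * Real.cos φ - p 0 * Real.sin φ) _ hr']
  congr 1
  · ring
  · linear_combination (-r) * hcs

theorem norm_idealPoint (φ : ℝ) : ‖idealPoint φ‖ = 1 := by
  rw [← sq_eq_sq₀ (norm_nonneg _) zero_le_one, KleinDisk.aux_norm]
  simp [idealPoint]

theorem IsPreconnected.inter_frontier_nonempty {X : Type*} [TopologicalSpace X] {s K : Set X}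
    (hs : IsPreconnected s) (h : (s ∩ K).Nonempty) (h' : (s ∩ Kᶜ).Nonempty) :
    (s ∩ frontier K).Nonempty := by
  by_contra hne
  have hdisj : ∀ x ∈ s, x ∉ frontier K := fun x hx hx' => hne ⟨x, hx, hx'⟩
  obtain ⟨x, -, hx1, hx2⟩ := hs (interior K) (closure K)ᶜ isOpen_interior
    isClosed_closure.isOpen_compl
    (fun x hx => by
      by_cases hxi : x ∈ interior K
      · exact Or.inl hxi
      · exact Or.inr fun hxc => hdisj x hx ⟨hxc, hxi⟩)
    (h.imp fun x hx => ⟨hx.1, by_contra fun hxi => hdisj x hx.1 ⟨subset_closure hx.2, hxi⟩⟩)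
    (h'.imp fun x hx => ⟨hx.1, fun hxc => hdisj x hx.1 ⟨hxc, fun hxi => hx.2
      (interior_subset hxi)⟩⟩)
  exact hx2 (interior_subset_closure hx1)

/-- The segment from `p` to `R` must leave `K`, since `R` lies on the unit circle; a frontier point
on it has the same projection as `p`. -/
theorem exists_mem_frontier_idealProj_eq {K : Set Plane} (hcl : IsClosed K) (hK : K ⊆ ball 0 1)
    (φ : ℝ) {p : Plane} (hp : p ∈ K) : ∃ x ∈ frontier K, idealProj φ x = idealProj φ p := by
  have hR : ∀ x ∈ K, x ≠ idealPoint φ := by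
    rintro _ hx rfl
    have := mem_ball_zero_iff.1 (hK hx)
    rw [norm_idealPoint] at this
    exact lt_irrefl _ this
  obtain ⟨x, hx, hxK⟩ := (convex_segment p (idealPoint φ)).isPreconnected.inter_frontier_nonempty
    ⟨p, left_mem_segment _ _ _, hp⟩
    ⟨idealPoint φ, right_mem_segment _ _ _, fun h => hR _ h rfl⟩
  rw [segment_eq_image'] at hx
  obtain ⟨r, -, rfl⟩ := hx
  refine ⟨_, hxK, idealProj_add_smul_idealPoint_sub ?_ p⟩
  rintro rfl
  exact hR _ (hcl.frontier_subset hxK) (by simp)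

/-- Polar coordinates about an interior point `c`: in the unit direction `e t` the boundary lies at
distance `1 / gauge S (e t)`, where `S` is `K` translated by `-c`. -/
theorem exists_isBoundaryCurve {K : Set Plane} (hconv : Convex ℝ K) (hc : IsCompact K)
    (hK : K ⊆ ball 0 1) (hint : (interior K).Nonempty) : ∃ γ, IsBoundaryCurve K γ := by
  obtain ⟨c, hcK⟩ := hint
  set S : Set Plane := (fun x => c + x) ⁻¹' K with hS
  have hS0 : S ∈ nhds 0 := by
    refine (continuous_const.add continuous_id).continuousAt.preimage_mem_nhds ?_
    simpa using mem_interior_iff_mem_nhds.1 hcK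
  have hSconv : Convex ℝ S := hconv.translate_preimage_right c
  have hSb : Bornology.IsVonNBounded ℝ S := by
    refine NormedSpace.isVonNBounded_of_isBounded ℝ ?_
    have : S = (Homeomorph.addLeft c) ⁻¹' K := rfl
    rw [this, ← Homeomorph.image_symm]
    exact (hc.image (Homeomorph.continuous _)).isBounded
  have hfr : ∀ x, c + x ∈ frontier K ↔ gauge S x = 1 := by
    intro x
    rw [gauge_eq_one_iff_mem_frontier hSconv hS0]
    have : S = (Homeomorph.addLeft c) ⁻¹' K := rfl
    rw [this, ← Homeomorph.preimage_frontier]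
    rfl
  have hg : Continuous (gauge S) := continuous_gauge hSconv hS0
  set e : ℝ → Plane := fun t => idealPoint (2 * Real.pi * t) with he
  have hec : Continuous e := by
    have : e = fun t => WithLp.toLp 2 ![Real.cos (2 * Real.pi * t), Real.sin (2 * Real.pi * t)] :=
      rfl
    rw [this]
    refine (PiLp.continuous_toLp 2 _).comp (continuous_pi fun i => ?_)
    fin_cases i
    · simp; fun_prop
    · simp; fun_prop
  have hen : ∀ t, ‖e t‖ = 1 := fun t => norm_idealPoint _
  have hgpos : ∀ x, x ≠ 0 → 0 < gauge S x := fun x hx =>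
    (gauge_pos (absorbent_nhds_zero hS0) hSb).2 hx
  have hge : ∀ t, 0 < gauge S (e t) := fun t => hgpos _ fun h => by
    have := hen t
    rw [h, norm_zero] at this
    exact zero_ne_one this
  have hmem : ∀ t, c + (gauge S (e t))⁻¹ • e t ∈ frontier K := fun t => by
    rw [hfr, gauge_smul_of_nonneg (inv_nonneg.2 (hge t).le), smul_eq_mul,
      inv_mul_cancel₀ (hge t).ne']
  refine ⟨fun t => ⟨c + (gauge S (e t))⁻¹ • e t,
    mem_ball_zero_iff.1 (hK (hc.isClosed.frontier_subset (hmem t)))⟩, ?_, ?_, ?_, ?_⟩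
  · refine Continuous.continuousOn ?_
    exact continuous_const.add (((hg.comp hec).inv₀ fun t => (hge t).ne').smul hec)
  · have : e 0 = e 1 := by simp [he, idealPoint]
    simp only [this]
  · intro t ht t' ht' htt
    have h1 : (gauge S (e t))⁻¹ • e t = (gauge S (e t'))⁻¹ • e t' :=
      add_left_cancel (congrArg KleinDisk.pt htt)
    have h2 := congrArg norm h1
    rw [norm_smul, norm_smul, hen, hen, mul_one, mul_one, Real.norm_of_nonneg
      (inv_nonneg.2 (hge t).le), Real.norm_of_nonneg (inv_nonneg.2 (hge t').le)] at h2
    rw [h2] at h1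
    have h3 : e t = e t' := smul_right_injective _ (inv_ne_zero (hge t').ne') h1
    have hcos : Real.cos (2 * Real.pi * t) = Real.cos (2 * Real.pi * t') := by
      simpa [he, idealPoint] using congrArg (fun x : Plane => x 0) h3
    have hsin : Real.sin (2 * Real.pi * t) = Real.sin (2 * Real.pi * t') := by
      simpa [he, idealPoint] using congrArg (fun x : Plane => x 1) h3
    have hone : Real.cos (2 * Real.pi * t - 2 * Real.pi * t') = 1 := by
      rw [Real.cos_sub, hcos, hsin]
      linarith [Real.cos_sq_add_sin_sq (2 * Real.pi * t')]
    have hpi := Real.pi_pos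
    -- For parameters in `[0, 1)` the angles differ by less than `2π`, so cosine `1` forces
    -- equality.
    have := (Real.cos_eq_one_iff_of_lt_of_lt (by nlinarith [ht.1, ht'.2])
      (by nlinarith [ht.2, ht'.1])).1 hone
    have h4 : 2 * Real.pi * (t - t') = 0 := by linarith
    exact sub_eq_zero.1 ((mul_eq_zero.1 h4).resolve_left (by positivity))
  · ext x
    constructor
    · rintro ⟨t, -, rfl⟩
      exact hmem t
    · intro hx
      have hx1 : gauge S (x - c) = 1 := by
        rw [← hfr, add_sub_cancel]; exact hx
      have hxc : x - c ≠ 0 := by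
        intro h
        rw [h, gauge_zero] at hx1
        exact zero_ne_one hx1
      have hn : 0 < ‖x - c‖ := norm_pos_iff.2 hxc
      obtain ⟨θ, hcθ, hsθ⟩ := exists_angle (x := (x - c) 0 / ‖x - c‖) (y := (x - c) 1 / ‖x - c‖) (by
        rw [div_pow, div_pow, ← add_div, ← KleinDisk.aux_norm, div_self (by positivity)])
      have hpi := Real.two_pi_pos
      refine ⟨Int.fract (θ / (2 * Real.pi)),
        ⟨Int.fract_nonneg _, (Int.fract_lt_one _).le⟩, ?_⟩
      have hang : 2 * Real.pi * Int.fract (θ / (2 * Real.pi)) =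
          θ - ⌊θ / (2 * Real.pi)⌋ * (2 * Real.pi) := by
        rw [Int.fract]; field_simp
      have hee : e (Int.fract (θ / (2 * Real.pi))) = ‖x - c‖⁻¹ • (x - c) := by
        simp only [he, hang, idealPoint, Real.cos_sub_int_mul_two_pi, Real.sin_sub_int_mul_two_pi,
          hcθ, hsθ]
        ext i
        fin_cases i
        · simp; ring
        · simp; ring
      simp only [hee]
      rw [gauge_smul_of_nonneg (by positivity), hx1, smul_smul]
      simp [hn.ne']

/-! ### The perimeter -/

theorem intervalIntegrable_projectedWidth (K : ConvexBody Plane)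
    (hK : (K : Set Plane) ⊆ ball 0 1) (a b : ℝ) :
    IntervalIntegrable (projectedWidth K) volume a b :=
  (continuous_projectedWidth K.isCompact K.nonempty hK).intervalIntegrable _ _

theorem sum_dist_eq_integral (p : ℕ → KleinDisk) (n : ℕ) :
    4 * ∑ i ∈ Finset.range n, dist (p (i + 1)) (p i) = ∫ φ in (0 : ℝ)..2 * Real.pi,
      ∑ i ∈ Finset.range n, |idealProj φ (p (i + 1)).pt - idealProj φ (p i).pt| := by
  rw [intervalIntegral.integral_finsetSum fun i _ =>
    (continuous_abs_idealProj_sub _ _).intervalIntegrable _ _, Finset.mul_sum]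
  exact Finset.sum_congr rfl fun i _ => (integral_abs_idealProj_sub _ _).symm

theorem sum_edist_eq_ofReal (p : ℕ → KleinDisk) (n : ℕ) :
    ∑ i ∈ Finset.range n, edist (p (i + 1)) (p i) =
      ENNReal.ofReal (∑ i ∈ Finset.range n, dist (p (i + 1)) (p i)) := by
  rw [ENNReal.ofReal_sum_of_nonneg fun i _ => dist_nonneg]
  simp only [edist_dist]

theorem continuous_sum_abs_idealProj_sub (p : ℕ → KleinDisk) (n : ℕ) :
    Continuous fun φ =>
      ∑ i ∈ Finset.range n, |idealProj φ (p (i + 1)).pt - idealProj φ (p i).pt| :=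
  continuous_finsetSum _ fun _ _ => continuous_abs_idealProj_sub _ _

/-! ### The length of a boundary curve -/

namespace IsBoundaryCurve

variable {K : ConvexBody Plane} {γ : ℝ → KleinDisk}

theorem mem_frontier (hγ : IsBoundaryCurve (K : Set Plane) γ) {t : ℝ} (ht : t ∈ Icc (0 : ℝ) 1) :
    (γ t).pt ∈ frontier (K : Set Plane) := by
  rw [← hγ.image_eq]
  exact ⟨t, ht, rfl⟩

theorem mem (hγ : IsBoundaryCurve (K : Set Plane) γ) {t : ℝ} (ht : t ∈ Icc (0 : ℝ) 1) :
    (γ t).pt ∈ (K : Set Plane) :=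
  K.isCompact.isClosed.frontier_subset (hγ.mem_frontier ht)

/-- A nonextremal level of `idealProj φ` meets `∂K` at most twice, and `γ` is injective on `(0, 1)`,
so the level-set bound on the variation applies. -/
theorem sum_abs_le (hγ : IsBoundaryCurve (K : Set Plane) γ) (hK : (K : Set Plane) ⊆ ball 0 1)
    (hint : (interior (K : Set Plane)).Nonempty) (φ : ℝ) {u : ℕ → ℝ} (hu : Monotone u)
    (huI : ∀ i, u i ∈ Icc (0 : ℝ) 1) (n : ℕ) :
    ∑ i ∈ Finset.range n, |idealProj φ (γ (u (i + 1))).pt - idealProj φ (γ (u i)).pt| ≤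
      2 * projectedWidth K φ := by
  obtain ⟨p, hp, q, hq, hw, hI⟩ :=
    exists_projectedWidth_eq K.isCompact K.nonempty hK φ
  rw [hw]
  refine sum_abs_sub_le_of_level_sets (g := fun t => idealProj φ (γ t).pt) ?_
    (fun t ht => hI _ (hγ.mem ht)) ?_ hu huI n
  · exact continuousOn_uncurry_idealProj continuousOn_const hγ.continuousOn
      fun t _ => (γ t).norm_lt_one
  · intro y hy
    obtain ⟨σ, hσ⟩ := exists_injOn_frontier_idealProj_eq K.convex K.isCompact.isClosed hK hint
      hp hq hy
    refine ⟨fun t => σ (γ t).pt, ?_⟩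
    rintro a ⟨ha, hay⟩ b ⟨hb, hby⟩ hab
    refine hγ.injOn ⟨ha.1.le, ha.2⟩ ⟨hb.1.le, hb.2⟩ (KleinDisk.ext ?_)
    exact hσ ⟨hγ.mem_frontier (Ioo_subset_Icc_self ha), hay⟩
      ⟨hγ.mem_frontier (Ioo_subset_Icc_self hb), hby⟩ hab

theorem eVariationOn_le (hγ : IsBoundaryCurve (K : Set Plane) γ)
    (hK : (K : Set Plane) ⊆ ball 0 1) (hint : (interior (K : Set Plane)).Nonempty) :
    eVariationOn γ (Icc 0 1) ≤
      ENNReal.ofReal (1 / 2 * ∫ φ in (0 : ℝ)..(2 * Real.pi), projectedWidth K φ) := by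
  refine iSup_le ?_
  rintro ⟨n, u, hu, huI⟩
  simp only
  rw [sum_edist_eq_ofReal fun i => γ (u i)]
  refine ENNReal.ofReal_le_ofReal ?_
  have h := sum_dist_eq_integral (fun i => γ (u i)) n
  have h2 : (∫ φ in (0 : ℝ)..2 * Real.pi, ∑ i ∈ Finset.range n,
      |idealProj φ (γ (u (i + 1))).pt - idealProj φ (γ (u i)).pt|) ≤
      ∫ φ in (0 : ℝ)..2 * Real.pi, 2 * projectedWidth K φ :=
    intervalIntegral.integral_mono_on Real.two_pi_pos.le
      ((continuous_sum_abs_idealProj_sub (fun i => γ (u i)) n).intervalIntegrable _ _)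
      ((intervalIntegrable_projectedWidth K hK _ _).const_mul 2)
      fun φ _ => hγ.sum_abs_le hK hint φ hu huI n
  rw [intervalIntegral.integral_const_mul] at h2
  linarith

/-- Joint uniform continuity in `(φ, t)` lets one partition serve every `φ`. Each extremal value is
attained on `∂K` and approximated at a node within `ε`; two such errors, doubled by the trip there
and back, cost `4ε`. -/
theorem exists_partition (hγ : IsBoundaryCurve (K : Set Plane) γ) (hK : (K : Set Plane) ⊆ ball 0 1)
    {ε : ℝ} (hε : 0 < ε) : ∃ (n : ℕ) (u : ℕ → ℝ), Monotone u ∧ (∀ i, u i ∈ Icc (0 : ℝ) 1) ∧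
      ∀ φ ∈ Icc 0 (2 * Real.pi), 2 * projectedWidth K φ - 4 * ε ≤
        ∑ i ∈ Finset.range n, |idealProj φ (γ (u (i + 1))).pt - idealProj φ (γ (u i)).pt| := by
  have hcont : ContinuousOn (fun x : ℝ × ℝ => idealProj x.1 (γ x.2).pt)
      (Icc 0 (2 * Real.pi) ×ˢ Icc 0 1) :=
    continuousOn_uncurry_idealProj (g := fun x : ℝ × ℝ => (γ x.2).pt) continuousOn_fst
      (hγ.continuousOn.comp continuousOn_snd fun x hx => hx.2) fun x _ => (γ x.2).norm_lt_one
  have huc := (isCompact_Icc.prod isCompact_Icc).uniformContinuousOn_of_continuous hcont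
  obtain ⟨δ, hδ, hδε⟩ := Metric.uniformContinuousOn_iff.1 huc ε hε
  obtain ⟨N, hN⟩ := exists_nat_one_div_lt hδ
  have hN0 : (0 : ℝ) < N + 1 := by positivity
  -- Truncation at `1` keeps the infinite sequence monotone and inside `[0, 1]`, while `u (N + 1) =
  -- 1` closes the polygon.
  set u : ℕ → ℝ := fun i => min (i / (N + 1)) 1 with hu
  have huI : ∀ i, u i ∈ Icc (0 : ℝ) 1 := fun i => ⟨le_min (by positivity) zero_le_one,
    min_le_right _ _⟩
  have hnear : ∀ t ∈ Icc (0 : ℝ) 1, ∃ i ≤ N + 1, |u i - t| < δ := by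
    intro t ht
    have h0 : 0 ≤ t * (N + 1) := mul_nonneg ht.1 hN0.le
    have hfl := Nat.floor_le h0
    have hlt := Nat.lt_floor_add_one (t * (N + 1))
    have hi1 : (⌊t * (N + 1)⌋₊ : ℝ) / (N + 1) ≤ t := (div_le_iff₀ hN0).2 hfl
    refine ⟨⌊t * (N + 1)⌋₊, Nat.floor_le_of_le ?_, ?_⟩
    · push_cast
      nlinarith [ht.2]
    · simp only [hu]
      rw [min_eq_left (hi1.trans ht.2), abs_sub_comm, abs_of_nonneg (sub_nonneg.2 hi1)]
      refine lt_of_le_of_lt ?_ hN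
      rw [sub_le_iff_le_add, ← add_div, le_div_iff₀ hN0]
      linarith
  refine ⟨N + 1, u, ?_, huI, ?_⟩
  · intro i j hij
    refine min_le_min_right _ (div_le_div_of_nonneg_right ?_ hN0.le)
    exact_mod_cast hij
  · intro φ hφ
    obtain ⟨p, hp, q, hq, hw, -⟩ := exists_projectedWidth_eq K.isCompact K.nonempty hK φ
    have happrox : ∀ p ∈ (K : Set Plane), ∃ i ≤ N + 1,
        |idealProj φ (γ (u i)).pt - idealProj φ p| < ε := by
      intro p hp
      obtain ⟨x, hx, hxp⟩ := exists_mem_frontier_idealProj_eq K.isCompact.isClosed hK φ hp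
      rw [← hγ.image_eq] at hx
      obtain ⟨t, ht, rfl⟩ := hx
      obtain ⟨i, hi, hit⟩ := hnear t ht
      refine ⟨i, hi, ?_⟩
      rw [← hxp, ← Real.dist_eq]
      refine hδε (φ, u i) ⟨hφ, huI i⟩ (φ, t) ⟨hφ, ht⟩ ?_
      rw [Prod.dist_eq, dist_self, Real.dist_eq]
      exact max_lt hδ hit
    obtain ⟨i, hi, hip⟩ := happrox p hp
    obtain ⟨j, hj, hjq⟩ := happrox q hq
    have hclosed : u (N + 1) = 1 ∧ u 0 = 0 := by
      constructor
      · simp only [hu]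
        push_cast
        rw [div_self hN0.ne', min_self]
      · simp [hu]
    have := two_mul_abs_sub_le_sum (a := fun i => idealProj φ (γ (u i)).pt) hi hj
      (by simp only [hclosed.1, hclosed.2, hγ.closed])
    refine le_trans ?_ this
    have h1 := le_abs_self (idealProj φ (γ (u i)).pt - idealProj φ (γ (u j)).pt)
    rw [hw]
    linarith [(abs_lt.1 hip).1, (abs_lt.1 hjq).2]

theorem le_eVariationOn (hγ : IsBoundaryCurve (K : Set Plane) γ)
    (hK : (K : Set Plane) ⊆ ball 0 1) :
    ENNReal.ofReal (1 / 2 * ∫ φ in (0 : ℝ)..(2 * Real.pi), projectedWidth K φ) ≤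
      eVariationOn γ (Icc 0 1) := by
  have hpi := Real.two_pi_pos
  refine ENNReal.le_of_forall_pos_le_add fun η hη _ => ?_
  have hη' : (0 : ℝ) < η := hη
  -- With this `ε`, the error `4ε` integrates over `[0, 2π]` to `4η`, that is, to `η` in the length.
  have hε : 0 < (η : ℝ) / (2 * Real.pi) := by positivity
  obtain ⟨n, u, hu, huI, hle⟩ := hγ.exists_partition hK hε
  have h := sum_dist_eq_integral (fun i => γ (u i)) n
  have h2 : (∫ φ in (0 : ℝ)..2 * Real.pi,
      (2 * projectedWidth K φ - 4 * ((η : ℝ) / (2 * Real.pi)))) ≤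
      (∫ φ in (0 : ℝ)..2 * Real.pi, ∑ i ∈ Finset.range n,
        |idealProj φ (γ (u (i + 1))).pt - idealProj φ (γ (u i)).pt|) :=
    intervalIntegral.integral_mono_on hpi.le
      (((intervalIntegrable_projectedWidth K hK _ _).const_mul 2).sub intervalIntegrable_const)
      ((continuous_sum_abs_idealProj_sub (fun i => γ (u i)) n).intervalIntegrable _ _) hle
  rw [intervalIntegral.integral_sub ((intervalIntegrable_projectedWidth K hK _ _).const_mul 2)
    intervalIntegrable_const, intervalIntegral.integral_const_mul,
    intervalIntegral.integral_const, smul_eq_mul, sub_zero,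
    show 2 * Real.pi * (4 * ((η : ℝ) / (2 * Real.pi))) = 4 * η by field_simp] at h2
  have h3 : 1 / 2 * ∫ φ in (0 : ℝ)..(2 * Real.pi), projectedWidth K φ ≤
      (∑ i ∈ Finset.range n, dist (γ (u (i + 1))) (γ (u i))) + η := by linarith
  refine (ENNReal.ofReal_le_ofReal h3).trans ?_
  rw [ENNReal.ofReal_add (Finset.sum_nonneg fun i _ => dist_nonneg) hη'.le,
    ENNReal.ofReal_coe_nnreal, ← sum_edist_eq_ofReal fun i => γ (u i)]
  gcongr
  exact eVariationOn.sum_le hu huI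

end IsBoundaryCurve

/-! ### Degenerate bodies -/

/-- A degenerate convex body in the plane is a segment. -/
theorem ConvexBody.exists_subset_segment (K : ConvexBody Plane)
    (hint : ¬ (interior (K : Set Plane)).Nonempty) :
    ∃ p ∈ (K : Set Plane), ∃ q ∈ (K : Set Plane), (K : Set Plane) ⊆ segment ℝ p q := by
  have hcol : Collinear ℝ (K : Set Plane) := by
    rw [K.convex.interior_nonempty_iff_affineSpan_eq_top] at hint
    rw [collinear_iff_finrank_le_one]
    have hne : vectorSpan ℝ (K : Set Plane) ≠ ⊤ := fun h => hint
      ((AffineSubspace.affineSpan_eq_top_iff_vectorSpan_eq_top_of_nonempty ℝ Plane Plane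
        K.nonempty).2 h)
    have := Submodule.finrank_lt hne
    rw [finrank_euclideanSpace_fin] at this
    omega
  -- A pair at maximal distance gives the endpoints: a collinear point of `K` beyond `p` or `q`
  -- would have to coincide with it.
  obtain ⟨⟨p, q⟩, ⟨hp, hq⟩, hmax⟩ := (K.isCompact.prod K.isCompact).exists_isMaxOn
    (K.nonempty.prod K.nonempty) (f := fun x : Plane × Plane => dist x.1 x.2)
    continuous_dist.continuousOn
  have hmax' : ∀ x ∈ (K : Set Plane), ∀ y ∈ (K : Set Plane), dist x y ≤ dist p q :=
    fun x hx y hy => hmax (a := (x, y)) ⟨hx, hy⟩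
  refine ⟨p, hp, q, hq, fun x hx => ?_⟩
  have h3 : Collinear ℝ ({p, x, q} : Set Plane) := hcol.subset (by
    rintro y (rfl | rfl | rfl) <;> assumption)
  rw [mem_segment_iff_wbtw]
  rcases h3.wbtw_or_wbtw_or_wbtw with h | h | h
  · exact h
  · have := h.dist_add_dist
    have h4 := hmax' x hx p hp
    rw [dist_comm x p, dist_comm p x] at *
    have : dist x q = 0 := le_antisymm (by linarith [dist_comm q p]) dist_nonneg
    rw [dist_eq_zero.1 this]
    exact wbtw_self_right _ _ _
  · have := h.dist_add_dist
    have h4 := hmax' q hq x hx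
    have : dist p x = 0 := le_antisymm (by linarith [dist_comm q p]) dist_nonneg
    rw [← dist_eq_zero.1 this]
    exact wbtw_self_left _ _ _

/-- Central projection preserves betweenness: the image of `a • p + b • q` is the average of the
images with weights proportional to `a * Dp` and `b * Dq`. -/
theorem abs_idealProj_sub_le_of_mem_segment {p q x y : Plane} (hp : ‖p‖ < 1) (hq : ‖q‖ < 1)
    (φ : ℝ) (hx : x ∈ segment ℝ p q) (hy : y ∈ segment ℝ p q) :
    |idealProj φ x - idealProj φ y| ≤ |idealProj φ p - idealProj φ q| := by
  have hmem : ∀ x ∈ segment ℝ p q, idealProj φ x ∈ uIcc (idealProj φ q) (idealProj φ p) := by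
    rintro x ⟨a, b, ha, hb, hab, rfl⟩
    have dp := one_sub_pos hp φ
    have dq := one_sub_pos hq φ
    set Dp := 1 - (p 0 * Real.cos φ + p 1 * Real.sin φ) with hDp
    set Dq := 1 - (q 0 * Real.cos φ + q 1 * Real.sin φ) with hDq
    have hD : 0 < a * Dp + b * Dq := by
      rcases ha.eq_or_lt with rfl | ha'
      · rw [zero_add] at hab
        rw [hab]
        linarith
      · have := mul_pos ha' dp
        have := mul_nonneg hb dq.le
        linarith
    have e : idealProj φ (a • p + b • q) =
        (a * Dp / (a * Dp + b * Dq)) • idealProj φ p +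
          (b * Dq / (a * Dp + b * Dq)) • idealProj φ q := by
      have e1 : 1 - ((a • p + b • q) 0 * Real.cos φ + (a • p + b • q) 1 * Real.sin φ) =
          a * Dp + b * Dq := by
        simp [hDp, hDq]
        linear_combination -hab
      rw [idealProj, e1, idealProj, idealProj, ← hDp, ← hDq, smul_eq_mul, smul_eq_mul]
      simp
      field_simp
      ring
    rw [← segment_eq_uIcc, segment_symm, e]
    refine ⟨_, _, by positivity, by positivity, ?_, rfl⟩
    rw [← add_div, div_self hD.ne']
  exact abs_sub_le_of_uIcc_subset_uIcc (uIcc_subset_uIcc (hmem y hy) (hmem x hx))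

/-- Integrating the pointwise inequality between projections shows that no two points of the segment
are hyperbolically farther apart than its endpoints. The two-point formula then gives `2 * dist = ½
∫ w`. -/
theorem two_mul_ediam_eq (K : ConvexBody Plane) (hK : (K : Set Plane) ⊆ ball 0 1)
    (hint : ¬ (interior (K : Set Plane)).Nonempty) :
    2 * ediam {p : KleinDisk | p.pt ∈ K} =
      ENNReal.ofReal (1 / 2 * ∫ φ in (0 : ℝ)..(2 * Real.pi), projectedWidth K φ) := by
  obtain ⟨p, hp, q, hq, hseg⟩ := K.exists_subset_segment hint
  have hp1 := mem_ball_zero_iff.1 (hK hp)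
  have hq1 := mem_ball_zero_iff.1 (hK hq)
  have hw : ∀ φ, projectedWidth K φ = |idealProj φ p - idealProj φ q| := by
    intro φ
    refine le_antisymm ?_ (abs_idealProj_sub_le K.isCompact hK φ hp hq)
    obtain ⟨x, hx, y, hy, hw, -⟩ := exists_projectedWidth_eq K.isCompact K.nonempty hK φ
    rw [hw]
    exact (le_abs_self _).trans
      (abs_idealProj_sub_le_of_mem_segment hp1 hq1 φ (hseg hx) (hseg hy))
  have hd : ediam {p : KleinDisk | p.pt ∈ K} = edist (⟨p, hp1⟩ : KleinDisk) ⟨q, hq1⟩ := by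
    refine le_antisymm (ediam_le fun x hx y hy => ?_) (edist_le_ediam_of_mem hp hq)
    rw [edist_dist, edist_dist]
    refine ENNReal.ofReal_le_ofReal ?_
    have : 4 * dist x y ≤ 4 * dist (⟨p, hp1⟩ : KleinDisk) ⟨q, hq1⟩ := by
      rw [← integral_abs_idealProj_sub, ← integral_abs_idealProj_sub]
      exact intervalIntegral.integral_mono_on Real.two_pi_pos.le
        ((continuous_abs_idealProj_sub _ _).intervalIntegrable _ _)
        ((continuous_abs_idealProj_sub _ _).intervalIntegrable _ _)
        fun φ _ => abs_idealProj_sub_le_of_mem_segment hp1 hq1 φ (hseg hx) (hseg hy)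
    linarith
  simp only [hw]
  rw [hd, edist_dist, show (2 : ℝ≥0∞) = ENNReal.ofReal 2 by simp,
    ← ENNReal.ofReal_mul zero_le_two, integral_abs_idealProj_sub ⟨p, hp1⟩ ⟨q, hq1⟩]
  congr 1
  ring

theorem theorem4p1 (K : ConvexBody Plane) (hK : (K : Set Plane) ⊆ Metric.ball 0 1) :
    IntervalIntegrable (projectedWidth K) MeasureTheory.volume 0 (2 * Real.pi) ∧
      HasHyperbolicPerimeter K
        (ENNReal.ofReal (1 / 2 * ∫ φ in (0 : ℝ)..(2 * Real.pi), projectedWidth K φ)) := by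
  refine ⟨intervalIntegrable_projectedWidth K hK _ _, fun hint => ⟨?_, fun γ hγ => ?_⟩,
    fun hint => two_mul_ediam_eq K hK hint⟩
  · exact exists_isBoundaryCurve K.convex K.isCompact hK hint
  · exact le_antisymm (hγ.eVariationOn_le hK hint) (hγ.le_eVariationOn hK)
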